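/- Let $N\ge 3$ and $2^*=2N/(N-2)$. Let $V:(0,\infty)\to[0,\infty]$ be a measurable function, finite almost everywhere, with $V\in L^1((r_1,r_2))$ for some $r_2>r_1>0$, and let $K:(0,\infty)\to(0,\infty)$ be a measurable function with $K\in L^s_{\mathrm{loc}}((0,\infty))$ for some $s>\frac{2N}{N+2}$. Let $$D^{1,2}(\mathbb R^N)=\{u\in L^{2^*}(\mathbb R^N):\nabla u\in L^2(\mathbb R^N)\},\qquad H^1_V=\Big\{u\in D^{1,2}(\mathbb R^N):\int_{\mathbb R^N}V(|x|)u^2\,dx<\infty\Big\},$$ with the norm $\|u\|^2=\int_{\mathbb R^N}(|\nabla u|^2+V(|x|)u^2)\,dx$, and let $H^1_{V,\mathrm r}$ be the closure in $H^1_V$ of the set of all radial $\varphi\in C^\infty_{\mathrm c}(\mathbb R^N)$ with $\int_{\mathbb R^N} V(|x|)\varphi^2\,dx<\infty$. For $q>1$ and $R>0$ put, with $B_R=\{x\in\mathbb R^N:|x|<R\}$, $$\mathcal R_0(q,R)=\sup\Big\{\int_{B_R}K(|x|)\,|u|^{q-1}|h|\,dx:\ u\in H^1_{V,\mathrm r},\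 h\in H^1_V,\ \|u\|=\|h\|=1\Big\}\in[0,\infty].$$ For $\alpha\in\mathbb R$, $\beta\le1$, $\gamma\ge2$ put $$q_*=2\,\frac{\alpha-\gamma\beta+N}{N-\gamma}\quad(\gamma\ne N),\qquad q_{**}=2\,\frac{2\alpha+(1-2\beta)\gamma+2(N-1)}{2(N-1)-\gamma}\quad(\gamma\neq 2N-2),$$ and let $\mathcal A_{\beta,\gamma}$ be the set of all $(\alpha,q)\in\mathbb R^2$ such that - $\max\{1,2\beta\}<q<\min\{q_*,q_{**}\}$, if $2\le\gamma<N$; - $\max\{1,2\beta\}<q<q_{**}$ and $\alpha>-(1-\beta)N$, if $\gamma=N$; - $\max\{1,2\beta,q_*\}<q<q_{**}$, if $N<\gamma<2N-2$; - $\max\{1,2\beta,q_*\}<q$ and $\alpha>-(1-\beta)\gamma$, if $\gamma=2N-2$; - $\max\{1,2\beta,q_*,q_{**}\}<q$, if $\gamma>2N-2$. Assume that there is $R_1>0$ such that $$\operatorname*{ess\,sup}_{r\in(0,R_1)}\frac{K(r)}{r^{\alpha_0}V(r)^{\beta_0}}<+\infty\quad\text{for some }0\le\beta_0\le1\text{ and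 }\alpha_0\in\mathbb R,$$ where $V(r)^0=1$ for every $r$, and $$\operatorname*{ess\,inf}_{r\in(0,R_1)}r^{\gamma_0}V(r)>0\quad\text{for some }\gamma_0\ge2.$$ Then $\displaystyle\lim_{R\to0^+}\mathcal R_0(q_1,R)=0$ for every $q_1\in\mathbb R$ such that $(\alpha_0,q_1)\in\mathcal A_{\beta_0,\gamma_0}$. -/

import Mathlib

open MeasureTheory Set Filter Topology
open scoped ENNReal NNReal ContDiff

noncomputable section

namespace RadialSobolev

/-- The Euclidean space `ℝ^N`. -/
abbrev Space (N : ℕ) := EuclideanSpace ℝ (Fin N)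

/-- Assumption `(V)` on a potential `V : (0,∞) → [0,∞]` (only the values on `(0,∞)` matter):
it is Lebesgue measurable, and integrable on some interval `(r₁, r₂)` with `r₂ > r₁ > 0`. -/
def AssumptionV (V : ℝ → ℝ≥0∞) : Prop :=
  AEMeasurable V (volume.restrict (Ioi 0)) ∧
    ∃ r₁ r₂ : ℝ, 0 < r₁ ∧ r₁ < r₂ ∧ ∫⁻ r in Ioo r₁ r₂, V r < ⊤

/-- Assumption `(K)` on a potential `K : (0,∞) → (0,∞)` (only the values on `(0,∞)` matter):
it is Lebesgue measurable, positive, and belongs to `L^s_loc((0,∞))` for some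
`s > 2N/(N+2)`. -/
def AssumptionK (N : ℕ) (K : ℝ → ℝ) : Prop :=
  AEMeasurable K (volume.restrict (Ioi 0)) ∧ (∀ r : ℝ, 0 < r → 0 < K r) ∧
    ∃ s : ℝ, 2 * (N : ℝ) / ((N : ℝ) + 2) < s ∧
      ∀ C : Set ℝ, C ⊆ Ioi 0 → IsCompact C → MemLp K (ENNReal.ofReal s) (volume.restrict C)

/-- `g` is the weak (distributional) gradient of `u` on `ℝ^N`. -/
def IsWeakGradient {N : ℕ} (u : Space N → ℝ) (g : Space N → Space N) : Prop :=
  LocallyIntegrable u ∧ LocallyIntegrable g ∧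
    ∀ φ : Space N → ℝ, ContDiff ℝ ∞ φ → HasCompactSupport φ → ∀ v : Space N,
      ∫ x, u x * fderiv ℝ φ x v = - ∫ x, φ x * inner ℝ (g x) v

open Classical in
/-- A version of the weak gradient of `u`, which is unique up to a null set when it exists
(the value is `0` if `u` has no weak gradient). -/
def weakGradient {N : ℕ} (u : Space N → ℝ) : Space N → Space N :=
  if h : ∃ g, IsWeakGradient u g then h.choose else 0

/-- The space `D^{1,2}(ℝ^N) = {u ∈ L^{2*} : ∇u ∈ L²}`, with `2* = 2N/(N-2)`. -/
def D12 (N : ℕ) : Set (Space N → ℝ) :=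
  {u | MemLp u (ENNReal.ofReal (2 * (N : ℝ) / ((N : ℝ) - 2))) ∧
    ∃ g, IsWeakGradient u g ∧ MemLp g 2}

/-- The space `H¹_V` of all `u ∈ D^{1,2}(ℝ^N)` such that `∫ V(|x|) u² dx < ∞`. -/
def HV {N : ℕ} (V : ℝ → ℝ≥0∞) : Set (Space N → ℝ) :=
  {u | u ∈ D12 N ∧ ∫⁻ x, V ‖x‖ * ‖u x‖ₑ ^ 2 < ⊤}

/-- The norm `‖u‖ = (∫ (|∇u|² + V(|x|) u²) dx)^{1/2}` of `H¹_V`, as an extended number. -/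
def normHV {N : ℕ} (V : ℝ → ℝ≥0∞) (u : Space N → ℝ) : ℝ≥0∞ :=
  (∫⁻ x, (‖weakGradient u x‖ₑ ^ 2 + V ‖x‖ * ‖u x‖ₑ ^ 2)) ^ (1 / 2 : ℝ)

/-- `C^∞_{c,rad}(ℝ^N)`: smooth radial functions with compact support. -/
def SmoothCompactRadial (N : ℕ) : Set (Space N → ℝ) :=
  {φ | ContDiff ℝ ∞ φ ∧ HasCompactSupport φ ∧ ∀ x y : Space N, ‖x‖ = ‖y‖ → φ x = φ y}

/-- The radial space `H¹_{V,r}`: the closure, in `H¹_V` with its norm, of the set of all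
`φ ∈ C^∞_{c,rad}(ℝ^N)` such that `∫ V(|x|) φ² dx < ∞`. -/
def HVrad {N : ℕ} (V : ℝ → ℝ≥0∞) : Set (Space N → ℝ) :=
  {u | u ∈ HV V ∧ ∀ ε : ℝ≥0∞, 0 < ε →
    ∃ φ ∈ SmoothCompactRadial N, ∫⁻ x, V ‖x‖ * ‖φ x‖ₑ ^ 2 < ⊤ ∧ normHV V (u - φ) < ε}

/-- `R₀(q,R)`: the supremum of `∫_{B_R} K(|x|) |u|^{q-1} |h| dx` over `u ∈ H¹_{V,r}` and
`h ∈ H¹_V` with `‖u‖ = ‖h‖ = 1`; it may be infinite. -/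
def R0 (N : ℕ) (V : ℝ → ℝ≥0∞) (K : ℝ → ℝ) (q R : ℝ) : ℝ≥0∞ :=
  ⨆ (u : Space N → ℝ) (h : Space N → ℝ) (_ : u ∈ HVrad V) (_ : h ∈ HV V)
    (_ : normHV V u = 1) (_ : normHV V h = 1),
    ∫⁻ x in Metric.ball (0 : Space N) R, ENNReal.ofReal (K ‖x‖) * ‖u x‖ₑ ^ (q - 1) * ‖h x‖ₑ

/-- `q_*(α,β,γ)`, meaningful for `γ ≠ N`. -/
def qStar (N : ℕ) (α β γ : ℝ) : ℝ := 2 * ((α - γ * β + N) / (N - γ))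

/-- `q_{**}(α,β,γ)`, meaningful for `γ ≠ 2N-2`. -/
def qStarStar (N : ℕ) (α β γ : ℝ) : ℝ :=
  2 * ((2 * α + (1 - 2 * β) * γ + 2 * ((N : ℝ) - 1)) / (2 * ((N : ℝ) - 1) - γ))

/-- The region `A_{β,γ}` of the `αq`-plane, for `β ≤ 1` and `γ ≥ 2`; the five branches are
`2 ≤ γ < N`, `γ = N`, `N < γ < 2N-2`, `γ = 2N-2` and `γ > 2N-2`. -/
def region (N : ℕ) (β γ : ℝ) : Set (ℝ × ℝ) :=
  {p | if γ < N then
        max 1 (2 * β) < p.2 ∧ p.2 < min (qStar N p.1 β γ) (qStarStar N p.1 β γ)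
      else if γ = N then
        max 1 (2 * β) < p.2 ∧ p.2 < qStarStar N p.1 β γ ∧ -(1 - β) * N < p.1
      else if γ < 2 * (N : ℝ) - 2 then
        max (max 1 (2 * β)) (qStar N p.1 β γ) < p.2 ∧ p.2 < qStarStar N p.1 β γ
      else if γ = 2 * (N : ℝ) - 2 then
        max (max 1 (2 * β)) (qStar N p.1 β γ) < p.2 ∧ -(1 - β) * γ < p.1
      else
        max (max (max 1 (2 * β)) (qStar N p.1 β γ)) (qStarStar N p.1 β γ) < p.2}

end RadialSobolev

end

namespace RadialSobolev

/-! Near the origin the hypotheses give `V ≥ c r^(-γ)` and `K ≤ S r^α V^β`. For any `δ ≥ 0`, `1 ≤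
c^(-δ) r^(γδ) V^δ`, so powers of `V` can be traded for powers of `r` (`le_mul_rpow_of_le`) until `V`
is fully absorbed by the unit norms of `u` and `h`. If `q < 2`, raise `V` to the power `q/2`: Hölder
leaves a power of the integral of `|x|^(2a/(2-q))` over the ball, with `a = α + γ(q/2 - β)`. It
tends to zero because the `q_*` condition puts the exponent above `-N`. If `q ≥ 2`, raise `V` to the
power `1`. Radial functions satisfy `|u| ≤ C r^(-ν)` with `ν = (N - 1 - γ/2)/2`
(`exists_HVrad_pointwise_bound`), so `K |u|^(q-1) |h|` is at most a constant times `r^(a - (q-2)ν) V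
|u| |h|`, now with `a = α + γ(1 - β)`. The `q_**` condition makes this exponent positive. -/

/-! ### Polar coordinates. -/

/-- Transfers almost-everywhere statements and measurability from radii to points of space. It
follows by integrating the indicator of a null set of radii in polar coordinates. -/
theorem quasiMeasurePreserving_norm {E : Type*} [NormedAddCommGroup E] [NormedSpace ℝ E]
    [FiniteDimensional ℝ E] [Nontrivial E] [MeasurableSpace E] [BorelSpace E]
    (μ : Measure E) [μ.IsAddHaarMeasure] :
    Measure.QuasiMeasurePreserving (fun x : E => ‖x‖) μ (volume.restrict (Ioi 0)) := by
  refine ⟨measurable_norm, Measure.AbsolutelyContinuous.mk fun Z hZ h0 => ?_⟩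
  rw [Measure.map_apply measurable_norm hZ]
  have hae : ∀ᵐ r ∂(volume.restrict (Ioi (0 : ℝ))), Z.indicator (1 : ℝ → ℝ) r = 0 := by
    filter_upwards [measure_eq_zero_iff_ae_notMem.1 h0] with r hr
    simp [hr]
  have hae' : (fun r : ℝ => r ^ (Module.finrank ℝ E - 1) • Z.indicator (1 : ℝ → ℝ) r)
      =ᵐ[volume.restrict (Ioi 0)] 0 := by
    filter_upwards [hae] with r hr
    simp [hr]
  have hint : Integrable (fun x : E => Z.indicator (1 : ℝ → ℝ) ‖x‖) μ :=
    (integrable_fun_norm_addHaar μ).2 ((integrable_zero _ _ _).congr hae'.symm)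
  have hzero : ∫ x : E, Z.indicator (1 : ℝ → ℝ) ‖x‖ ∂μ = 0 := by
    rw [integral_fun_norm_addHaar, integral_congr_ae hae']
    simp
  rw [integral_eq_zero_iff_of_nonneg (fun x => indicator_nonneg (by simp) _) hint] at hzero
  rw [measure_eq_zero_iff_ae_notMem]
  filter_upwards [hzero] with x hx hxZ
  have : Z.indicator (1 : ℝ → ℝ) ‖x‖ = 1 :=
    indicator_of_mem (show ‖x‖ ∈ Z from hxZ) _
  simp [this] at hx

theorem setIntegral_ball_fun_norm {E : Type*} [NormedAddCommGroup E] [NormedSpace ℝ E]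
    [FiniteDimensional ℝ E] [Nontrivial E] [MeasurableSpace E] [BorelSpace E]
    (μ : Measure E) [μ.IsAddHaarMeasure] (f : ℝ → ℝ) (ρ : ℝ) :
    ∫ x in Metric.ball (0 : E) ρ, f ‖x‖ ∂μ = Module.finrank ℝ E * (μ.real (Metric.ball 0 1) *
      ∫ r in Ioo 0 ρ, r ^ (Module.finrank ℝ E - 1) * f r) := by
  have h := integral_fun_norm_addHaar μ ((Iio ρ).indicator f)
  rw [← integral_indicator measurableSet_ball]
  have h1 : (Metric.ball (0 : E) ρ).indicator (fun x => f ‖x‖)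
      = fun x => (Iio ρ).indicator f ‖x‖ := by
    ext x
    simp [indicator]
  rw [h1, h, nsmul_eq_mul, smul_eq_mul]
  congr 2
  have h2 : (fun y : ℝ => y ^ (Module.finrank ℝ E - 1) • (Iio ρ).indicator f y)
      = (Iio ρ).indicator (fun r => r ^ (Module.finrank ℝ E - 1) * f r) := by
    ext x
    simp [indicator]
  rw [h2, integral_indicator measurableSet_Iio, Measure.restrict_restrict measurableSet_Iio,
    Iio_inter_Ioi]

/-! ### Pointwise decay in one variable. -/

/-- A weighted one-dimensional trace estimate away from the endpoint `0`. -/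
theorem rpow_mul_sq_le_integral {f : ℝ → ℝ} (hf : ContDiff ℝ 1 f) {n : ℕ} {γ ρ : ℝ}
    (hγ : 2 ≤ γ) (hρ1 : ρ ≤ 1)
    (hint : IntegrableOn (fun s : ℝ => s ^ n * (deriv f s ^ 2 + s ^ (-γ) * f s ^ 2)) (Ioo 0 ρ))
    {r : ℝ} (hr : 0 < r) (hrρ : r < ρ / 2) :
    r ^ ((n : ℝ) - γ / 2) * f r ^ 2 ≤ 2 / ρ * ((|(n : ℝ) - γ / 2| + 2) *
      ∫ s in Ioo 0 ρ, s ^ n * (deriv f s ^ 2 + s ^ (-γ) * f s ^ 2)) := by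
  set σ : ℝ := (n : ℝ) - γ / 2 with hσ
  set D : ℝ → ℝ := fun s => s ^ n * (deriv f s ^ 2 + s ^ (-γ) * f s ^ 2) with hD
  have hρ : 0 < ρ := by linarith
  have hrρ' : r ≤ ρ := by linarith
  have hfd : ∀ s, HasDerivAt f (deriv f s) s := fun s =>
    (hf.differentiable (by norm_num) s).hasDerivAt
  -- The factor `ρ - s` removes the boundary term at `ρ`, and the sign makes `g ρ - g r` the
  -- quantity to bound, so only an upper bound on the derivative is needed.
  set g : ℝ → ℝ := fun s => -((ρ - s) * (s ^ σ * f s ^ 2)) with hg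
  have hgd : ∀ s, 0 < s → HasDerivAt g
      (-((-1) * (s ^ σ * f s ^ 2) + (ρ - s) *
        (σ * s ^ (σ - 1) * f s ^ 2 + s ^ σ * (2 * f s * deriv f s)))) s := by
    intro s hs
    have h1 : HasDerivAt (fun s : ℝ => s ^ σ) (σ * s ^ (σ - 1)) s :=
      Real.hasDerivAt_rpow_const (Or.inl hs.ne')
    have h2 : HasDerivAt (fun s => f s ^ 2) (2 * f s * deriv f s) s := by
      simpa using (hfd s).fun_pow 2
    have h3 : HasDerivAt (fun s => ρ - s) (-1) s := by
      simpa using (hasDerivAt_id s).const_sub ρ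
    exact (h3.mul (h1.mul h2)).neg
  have hDnn : ∀ s, 0 < s → 0 ≤ D s := fun s hs => by
    simp only [hD]; positivity
  have hIoo : IntegrableOn D (Ioc 0 ρ) := (integrableOn_Ioc_iff_integrableOn_Ioo).2 hint
  have hIcc : IntegrableOn (fun s => (|σ| + 2) * D s) (Icc r ρ) :=
    (hIoo.mono_set fun s hs => ⟨hr.trans_le hs.1, hs.2⟩).const_mul _
  have key := intervalIntegral.sub_le_integral_of_hasDeriv_right_of_le hrρ'
    (fun s hs => (hgd s (hr.trans_le hs.1)).continuousAt.continuousWithinAt)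
    (fun s hs => (hgd s (hr.trans hs.1)).hasDerivWithinAt) hIcc ?_
  · rw [intervalIntegral.integral_of_le hrρ', integral_const_mul] at key
    have h1 : ∫ s in Ioc r ρ, D s ≤ ∫ s in Ioo 0 ρ, D s := by
      rw [← integral_Ioc_eq_integral_Ioo]
      refine setIntegral_mono_set hIoo ?_ ?_
      · filter_upwards [ae_restrict_mem measurableSet_Ioc] with s hs using hDnn s hs.1
      · exact (Ioc_subset_Ioc_left hr.le).eventuallyLE
    have h2 : (ρ - r) * (r ^ σ * f r ^ 2) ≤ (|σ| + 2) * ∫ s in Ioo 0 ρ, D s := by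
      have : g ρ - g r = (ρ - r) * (r ^ σ * f r ^ 2) := by simp [hg]
      rw [← this]
      exact key.trans (mul_le_mul_of_nonneg_left h1 (by positivity))
    -- The constant `2 / ρ` comes from `ρ - r ≥ ρ / 2`.
    have h3 : ρ / 2 * (r ^ σ * f r ^ 2) ≤ (ρ - r) * (r ^ σ * f r ^ 2) :=
      mul_le_mul_of_nonneg_right (by linarith) (by positivity)
    have h4 := h3.trans h2
    rw [div_mul_eq_mul_div, le_div_iff₀ hρ]
    linarith
  · intro s hs
    have hs0 : 0 < s := hr.trans hs.1
    have hs1 : s ≤ 1 := hs.2.le.trans hρ1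
    set P : ℝ := s ^ ((n : ℝ) - γ) * f s ^ 2 with hP
    have hDs : D s = s ^ n * deriv f s ^ 2 + P := by
      simp only [hD, hP]
      rw [sub_eq_add_neg, Real.rpow_add hs0, Real.rpow_natCast]
      ring
    -- Both exponents `σ` and `σ - 1` are at least `n - γ`, the latter because `γ ≥ 2`; with `s ≤ 1`
    -- the powers compare the other way.
    have e1 : s ^ σ * f s ^ 2 ≤ P := mul_le_mul_of_nonneg_right
      (Real.rpow_le_rpow_of_exponent_ge hs0 hs1 (by linarith)) (sq_nonneg _)
    have e2 : s ^ (σ - 1) * f s ^ 2 ≤ P := mul_le_mul_of_nonneg_right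
      (Real.rpow_le_rpow_of_exponent_ge hs0 hs1 (by linarith)) (sq_nonneg _)
    -- The choice `σ = n - γ/2` is the mean of the exponents `n` and `n - γ`, so the cross term is
    -- controlled by completing a square.
    have e3 : -(s ^ σ * (2 * f s * deriv f s)) ≤ D s := by
      have ha : s ^ σ = s ^ ((n : ℝ) / 2) * s ^ (((n : ℝ) - γ) / 2) := by
        rw [← Real.rpow_add hs0]; congr 1; rw [hσ]; ring
      have hb : (s ^ ((n : ℝ) / 2)) ^ 2 = s ^ n := by
        rw [← Real.rpow_natCast, ← Real.rpow_mul hs0.le, ← Real.rpow_natCast]; congr 1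
        push_cast; ring
      have hc : (s ^ (((n : ℝ) - γ) / 2)) ^ 2 = s ^ ((n : ℝ) - γ) := by
        rw [← Real.rpow_natCast, ← Real.rpow_mul hs0.le]; congr 1
        push_cast; ring
      rw [hDs, hP, ha, ← hb, ← hc]
      nlinarith [sq_nonneg (s ^ ((n : ℝ) / 2) * deriv f s + s ^ (((n : ℝ) - γ) / 2) * f s)]
    have hPnn : 0 ≤ P := by positivity
    have hQnn : 0 ≤ s ^ n * deriv f s ^ 2 := by positivity
    have hPD : P ≤ D s := by linarith
    have e4 : -(σ * s ^ (σ - 1) * f s ^ 2) ≤ |σ| * D s := by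
      have : -(σ * s ^ (σ - 1) * f s ^ 2) = (-σ) * (s ^ (σ - 1) * f s ^ 2) := by ring
      rw [this]
      exact mul_le_mul (neg_le_abs σ) (e2.trans hPD) (by positivity) (abs_nonneg _)
    have e5 : (ρ - s) * (-(σ * s ^ (σ - 1) * f s ^ 2) + -(s ^ σ * (2 * f s * deriv f s)))
        ≤ |σ| * D s + D s := by
      have hnn : 0 ≤ |σ| * D s + D s := by
        have := hDnn s hs0; positivity
      calc _ ≤ (ρ - s) * (|σ| * D s + D s) :=
            mul_le_mul_of_nonneg_left (add_le_add e4 e3) (by linarith [hs.2])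
        _ ≤ 1 * (|σ| * D s + D s) := mul_le_mul_of_nonneg_right (by linarith) hnn
        _ = _ := one_mul _
    linarith

/-! ### Weak gradients. -/

theorem IsWeakGradient.sub {N : ℕ} {u w : Space N → ℝ} {g k : Space N → Space N}
    (hu : IsWeakGradient u g) (hw : IsWeakGradient w k) : IsWeakGradient (u - w) (g - k) := by
  refine ⟨hu.1.sub hw.1, hu.2.1.sub hw.2.1, fun φ hφ hc v => ?_⟩
  have hφ' : Continuous fun x => fderiv ℝ φ x v :=
    (hφ.continuous_fderiv (by simp)).clm_apply continuous_const
  have hc' : HasCompactSupport fun x => fderiv ℝ φ x v := hc.fderiv_apply ℝ v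
  have i1 : ∀ {z : Space N → ℝ}, LocallyIntegrable z →
      Integrable fun x => z x * fderiv ℝ φ x v := fun hz => by
    simpa [mul_comm] using hz.integrable_smul_left_of_hasCompactSupport hφ' hc'
  have i2 : ∀ {z : Space N → Space N}, LocallyIntegrable z →
      Integrable fun x => φ x * inner ℝ (z x) v := fun hz => by
    simpa [inner_smul_left] using
      (hz.integrable_smul_left_of_hasCompactSupport hφ.continuous hc).inner_const (𝕜 := ℝ) v
  simp only [Pi.sub_apply, sub_mul, inner_sub_left, mul_sub]
  rw [integral_sub (i1 hu.1) (i1 hw.1), integral_sub (i2 hu.2.1) (i2 hw.2.1),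
    hu.2.2 φ hφ hc v, hw.2.2 φ hφ hc v]
  ring

/-- Makes the chosen `weakGradient` usable: up to a null set it agrees with any explicit gradient,
hence behaves linearly. -/
theorem IsWeakGradient.ae_eq {N : ℕ} {u : Space N → ℝ} {g k : Space N → Space N}
    (hg : IsWeakGradient u g) (hk : IsWeakGradient u k) : g =ᵐ[volume] k := by
  refine ae_eq_of_integral_contDiff_smul_eq hg.2.1 hk.2.1 fun φ hφ hc => ?_
  refine ext_inner_left ℝ fun v => ?_
  rw [← integral_inner (hg.2.1.integrable_smul_left_of_hasCompactSupport hφ.continuous hc),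
    ← integral_inner (hk.2.1.integrable_smul_left_of_hasCompactSupport hφ.continuous hc)]
  have h := (hg.2.2 φ hφ hc v).symm.trans (hk.2.2 φ hφ hc v)
  simpa [inner_smul_right, real_inner_comm] using h

theorem isWeakGradient_weakGradient {N : ℕ} {u : Space N → ℝ} {g : Space N → Space N}
    (hg : IsWeakGradient u g) : IsWeakGradient u (weakGradient u) := by
  have h : ∃ g, IsWeakGradient u g := ⟨g, hg⟩
  rw [weakGradient, dif_pos h]
  exact h.choose_spec

theorem isWeakGradient_gradient {N : ℕ} {φ : Space N → ℝ} (hφ : ContDiff ℝ ∞ φ)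
    (hc : HasCompactSupport φ) : IsWeakGradient φ (gradient φ) := by
  have hd : Continuous (fderiv ℝ φ) := hφ.continuous_fderiv (by simp)
  have hgr : Continuous (gradient φ) :=
    (InnerProductSpace.toDual ℝ (Space N)).symm.continuous.comp hd
  refine ⟨hφ.continuous.locallyIntegrable, hgr.locallyIntegrable, fun ψ hψ hcψ v => ?_⟩
  have hdψ : Continuous (fderiv ℝ ψ) := hψ.continuous_fderiv (by simp)
  rw [integral_mul_fderiv_eq_neg_fderiv_mul_of_integrable]
  · congr 1
    refine integral_congr_ae (Eventually.of_forall fun x => ?_)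
    simp [gradient, mul_comm]
  · exact ((hd.clm_apply continuous_const).mul hψ.continuous).integrable_of_hasCompactSupport
      hcψ.mul_left
  · exact (hφ.continuous.mul (hdψ.clm_apply continuous_const)).integrable_of_hasCompactSupport
      hc.mul_right
  · exact (hφ.continuous.mul hψ.continuous).integrable_of_hasCompactSupport hc.mul_right
  · exact fun x _ => hφ.differentiable (by simp) x
  · exact fun x _ => hψ.differentiable (by simp) x

/-! ### Decay of smooth radial functions. -/

/-- The pointwise decay of smooth radial functions near the origin. -/
theorem exists_radial_pointwise_bound {N : ℕ} (hN : N ≠ 0) {γ ρ : ℝ} (hγ : 2 ≤ γ) (hρ : 0 < ρ)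
    (hρ1 : ρ ≤ 1) :
    ∃ C : ℝ, 0 ≤ C ∧ ∀ φ ∈ SmoothCompactRadial N, ∀ M : ℝ, 0 ≤ M →
      ∫⁻ x in Metric.ball (0 : Space N) ρ,
        (‖fderiv ℝ φ x‖ₑ ^ 2 + ENNReal.ofReal (‖x‖ ^ (-γ)) * ‖φ x‖ₑ ^ 2) ≤ ENNReal.ofReal M →
      ∀ x : Space N, x ≠ 0 → ‖x‖ < ρ / 2 →
        ‖x‖ ^ (((N - 1 : ℕ) : ℝ) - γ / 2) * φ x ^ 2 ≤ C * M := by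
  have : Nonempty (Fin N) := ⟨⟨0, Nat.pos_of_ne_zero hN⟩⟩
  have : Nontrivial (Space N) := inferInstance
  set v : ℝ := volume.real (Metric.ball (0 : Space N) 1) with hv
  have hvpos : 0 < v := ENNReal.toReal_pos (Metric.measure_ball_pos _ _ one_pos).ne'
    measure_ball_lt_top.ne
  have hNpos : (0 : ℝ) < N := by exact_mod_cast Nat.pos_of_ne_zero hN
  refine ⟨2 / ρ * ((|((N - 1 : ℕ) : ℝ) - γ / 2| + 2) / (N * v)), by positivity, ?_⟩
  rintro φ ⟨hφ, -, hrad⟩ M hM hE x hx hxρ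
  have hdφ : Continuous (fderiv ℝ φ) := hφ.continuous_fderiv (by simp)
  -- The profile is the same along every ray, so its derivative at `‖y‖` can be computed on the ray
  -- through `y` and compared with the full derivative there.
  have hline : ∀ y : Space N, y ≠ 0 →
      (fun r : ℝ => φ (r • (‖y‖⁻¹ • y))) = fun r : ℝ => φ (r • (‖x‖⁻¹ • x)) := by
    intro y hy
    ext r
    apply hrad
    simp [norm_smul, hx, hy]
  set f : ℝ → ℝ := fun r => φ (r • (‖x‖⁻¹ • x)) with hf
  have hfc : ContDiff ℝ 1 f := by
    have : ContDiff ℝ 1 φ := hφ.of_le (by exact_mod_cast le_top)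
    exact this.comp (contDiff_id.smul contDiff_const)
  have hfn : ∀ y, f ‖y‖ = φ y := fun y => hrad _ _ (by simp [norm_smul, hx])
  have hfd : ∀ y : Space N, y ≠ 0 → |deriv f ‖y‖| ≤ ‖fderiv ℝ φ y‖ := by
    intro y hy
    have hy' : ‖y‖ ≠ 0 := norm_ne_zero_iff.2 hy
    have hyy : ‖y‖ • (‖y‖⁻¹ • y) = y := by rw [smul_smul, mul_inv_cancel₀ hy', one_smul]
    have h1 : HasDerivAt (fun r : ℝ => r • (‖y‖⁻¹ • y)) (‖y‖⁻¹ • y) ‖y‖ := by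
      simpa using (hasDerivAt_id ‖y‖).smul_const (‖y‖⁻¹ • y)
    have h2 : HasFDerivAt φ (fderiv ℝ φ y) (‖y‖ • (‖y‖⁻¹ • y)) := by
      rw [hyy]; exact (hφ.differentiable (by simp) y).hasFDerivAt
    have h3 := h2.comp_hasDerivAt _ h1
    have h4 : HasDerivAt f (fderiv ℝ φ y (‖y‖⁻¹ • y)) ‖y‖ := by
      rw [← hline y hy]; exact h3
    rw [h4.deriv, ← Real.norm_eq_abs]
    refine ((fderiv ℝ φ y).le_opNorm _).trans_eq ?_
    simp [norm_smul, hy]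
  have hdfc : Continuous (deriv f) := hfc.continuous_deriv le_rfl
  set G : ℝ → ℝ := fun s => deriv f s ^ 2 + s ^ (-γ) * f s ^ 2 with hG
  have hGm : Measurable G := by
    have := hdfc.measurable
    have := hfc.continuous.measurable
    fun_prop
  have hGnn : ∀ y : Space N, 0 ≤ G ‖y‖ := fun y => by simp only [hG]; positivity
  have hle : ∫⁻ y in Metric.ball (0 : Space N) ρ, ENNReal.ofReal (G ‖y‖) ≤ ENNReal.ofReal M := by
    refine le_trans (lintegral_mono_ae ?_) hE
    have h0 : ∀ᵐ y : Space N, y ≠ 0 := by simp [ae_iff]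
    filter_upwards [ae_restrict_of_ae h0] with y hy
    simp only [hG]
    rw [ENNReal.ofReal_add (by positivity) (by positivity), ENNReal.ofReal_mul (by positivity), hfn]
    gcongr
    · rw [← ofReal_norm, ← ENNReal.ofReal_pow (norm_nonneg _)]
      refine ENNReal.ofReal_le_ofReal ?_
      rw [← sq_abs]
      exact pow_le_pow_left₀ (abs_nonneg _) (hfd y hy) 2
    · rw [← ofReal_norm, ← ENNReal.ofReal_pow (norm_nonneg _), Real.norm_eq_abs, sq_abs]
  have hint : IntegrableOn (fun y : Space N => G ‖y‖) (Metric.ball 0 ρ) := by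
    refine ⟨(hGm.comp measurable_norm).aestronglyMeasurable, ?_⟩
    rw [hasFiniteIntegral_iff_ofReal (Eventually.of_forall hGnn)]
    exact hle.trans_lt ENNReal.ofReal_lt_top
  have hfin : Module.finrank ℝ (Space N) = N := by simp
  have hint1 := (integrableOn_fun_norm_addHaar volume).1 hint
  rw [hfin] at hint1
  have hI : ∫ y in Metric.ball (0 : Space N) ρ, G ‖y‖ ≤ M := by
    rw [← ENNReal.ofReal_le_ofReal_iff hM,
      ofReal_integral_eq_lintegral_ofReal hint (Eventually.of_forall hGnn)]
    exact hle
  rw [setIntegral_ball_fun_norm, hfin] at hI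
  have key := rpow_mul_sq_le_integral hfc hγ hρ1 hint1 (norm_pos_iff.2 hx) hxρ
  rw [hfn] at key
  set I : ℝ := ∫ s in Ioo 0 ρ, s ^ (N - 1) * (deriv f s ^ 2 + s ^ (-γ) * f s ^ 2)
  have hI' : I ≤ M / (N * v) := by
    rw [le_div_iff₀ (by positivity)]
    calc I * (N * v) = N * (v * I) := by ring
      _ ≤ M := hI
  calc _ ≤ 2 / ρ * ((|((N - 1 : ℕ) : ℝ) - γ / 2| + 2) * I) := key
    _ ≤ 2 / ρ * ((|((N - 1 : ℕ) : ℝ) - γ / 2| + 2) * (M / (N * v))) := by gcongr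
    _ = _ := by ring

/-! ### Energy and decay in the radial closure. -/

theorem lintegral_eq_one_of_normHV {N : ℕ} {V : ℝ → ℝ≥0∞} {u : Space N → ℝ}
    (hu : normHV V u = 1) :
    ∫⁻ x, (‖weakGradient u x‖ₑ ^ 2 + V ‖x‖ * ‖u x‖ₑ ^ 2) = 1 := by
  have h := congrArg (fun t : ℝ≥0∞ => t ^ (2 : ℝ)) hu
  simp only [normHV, ENNReal.one_rpow] at h
  rw [← ENNReal.rpow_mul] at h
  simpa using h

theorem lintegral_le_of_normHV_lt {N : ℕ} {V : ℝ → ℝ≥0∞} {u : Space N → ℝ} {ε : ℝ≥0∞}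
    (hu : normHV V u < ε) (hε : ε ≤ 1) :
    ∫⁻ x, (‖weakGradient u x‖ₑ ^ 2 + V ‖x‖ * ‖u x‖ₑ ^ 2) ≤ ε := by
  have h : (normHV V u) ^ (2 : ℝ) ≤ ε ^ (2 : ℝ) := ENNReal.rpow_le_rpow hu.le (by norm_num)
  rw [normHV, ← ENNReal.rpow_mul] at h
  refine le_trans (by simpa using h) ?_
  calc ε ^ 2 = ε * ε := sq ε
    _ ≤ 1 * ε := by gcongr
    _ = ε := one_mul ε

theorem aemeasurable_potential_norm {N : ℕ} (hN : N ≠ 0) {V : ℝ → ℝ≥0∞}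
    (hV : AEMeasurable V (volume.restrict (Ioi 0))) :
    AEMeasurable (fun x : Space N => V ‖x‖) := by
  have : Nonempty (Fin N) := ⟨⟨0, Nat.pos_of_ne_zero hN⟩⟩
  exact hV.comp_quasiMeasurePreserving (quasiMeasurePreserving_norm volume)

theorem enorm_sub_sq_le {E : Type*} [NormedAddCommGroup E] (a b : E) :
    ‖a - b‖ₑ ^ 2 ≤ 2 * ‖a‖ₑ ^ 2 + 2 * ‖b‖ₑ ^ 2 := by
  have h : ‖a - b‖ ^ 2 ≤ 2 * ‖a‖ ^ 2 + 2 * ‖b‖ ^ 2 := by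
    have := pow_le_pow_left₀ (norm_nonneg _) (norm_sub_le a b) 2
    nlinarith [sq_nonneg (‖a‖ - ‖b‖)]
  have h' : ‖a - b‖₊ ^ 2 ≤ 2 * ‖a‖₊ ^ 2 + 2 * ‖b‖₊ ^ 2 := by exact_mod_cast h
  simp only [enorm_eq_nnnorm]
  exact_mod_cast h'

theorem aemeasurable_energy {N : ℕ} (hN : N ≠ 0) {V : ℝ → ℝ≥0∞}
    (hV : AEMeasurable V (volume.restrict (Ioi 0))) {u : Space N → ℝ} (hu : u ∈ D12 N) :
    AEMeasurable fun x => ‖weakGradient u x‖ₑ ^ 2 + V ‖x‖ * ‖u x‖ₑ ^ 2 := by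
  obtain ⟨hm, g, hg, -⟩ := hu
  exact ((isWeakGradient_weakGradient hg).2.1.aestronglyMeasurable.enorm.pow_const 2).add
    ((aemeasurable_potential_norm hN hV).mul (hm.1.enorm.pow_const 2))

/-- Write `φ = u - (u - φ)` and apply `|a - b|² ≤ 2|a|² + 2|b|²`; this bounds the energies of all
close approximants uniformly. -/
theorem lintegral_energy_smooth_le {N : ℕ} (hN : N ≠ 0) {V : ℝ → ℝ≥0∞}
    (hV : AEMeasurable V (volume.restrict (Ioi 0))) {u φ : Space N → ℝ} (hu : u ∈ D12 N)
    (hφ : ContDiff ℝ ∞ φ) (hc : HasCompactSupport φ) :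
    ∫⁻ x, (‖fderiv ℝ φ x‖ₑ ^ 2 + V ‖x‖ * ‖φ x‖ₑ ^ 2) ≤
      2 * (∫⁻ x, (‖weakGradient u x‖ₑ ^ 2 + V ‖x‖ * ‖u x‖ₑ ^ 2)) +
      2 * ∫⁻ x, (‖weakGradient (u - φ) x‖ₑ ^ 2 + V ‖x‖ * ‖(u - φ) x‖ₑ ^ 2) := by
  have hmeas := aemeasurable_energy hN hV hu
  obtain ⟨-, g, hg, -⟩ := hu
  have hgu := isWeakGradient_weakGradient hg
  have hsub := hgu.sub (isWeakGradient_gradient hφ hc)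
  have hae := (isWeakGradient_weakGradient hsub).ae_eq hsub
  rw [← lintegral_const_mul' _ _ (by simp), ← lintegral_const_mul' _ _ (by simp),
    ← lintegral_add_left' (hmeas.const_mul _)]
  refine lintegral_mono_ae ?_
  filter_upwards [hae] with x hx
  have h1 : ‖fderiv ℝ φ x‖ₑ = ‖weakGradient u x - weakGradient (u - φ) x‖ₑ := by
    rw [hx]
    simp [gradient, enorm_eq_nnnorm]
  have h2 : φ x = u x - (u - φ) x := by simp
  calc ‖fderiv ℝ φ x‖ₑ ^ 2 + V ‖x‖ * ‖φ x‖ₑ ^ 2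
      ≤ (2 * ‖weakGradient u x‖ₑ ^ 2 + 2 * ‖weakGradient (u - φ) x‖ₑ ^ 2) +
        V ‖x‖ * (2 * ‖u x‖ₑ ^ 2 + 2 * ‖(u - φ) x‖ₑ ^ 2) := by
        rw [h1]
        nth_rewrite 1 [h2]
        gcongr <;> exact enorm_sub_sq_le _ _
    _ = _ := by ring

/-- The pointwise decay of functions in the radial space near the origin. -/
theorem exists_HVrad_pointwise_bound {N : ℕ} (hN : N ≠ 0) {V : ℝ → ℝ≥0∞}
    (hV : AEMeasurable V (volume.restrict (Ioi 0))) {γ ρ c : ℝ} (hγ : 2 ≤ γ) (hρ : 0 < ρ)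
    (hρ1 : ρ ≤ 1) (hc : 0 < c)
    (hlow : ∀ᵐ x : Space N, ‖x‖ < ρ → ENNReal.ofReal (c * ‖x‖ ^ (-γ)) ≤ V ‖x‖) :
    ∃ C : ℝ, 0 ≤ C ∧ ∀ u ∈ HVrad (N := N) V, normHV V u = 1 → ∀ᵐ x : Space N, ‖x‖ < ρ / 2 →
      ‖u x‖ₑ ≤ ENNReal.ofReal (C * ‖x‖ ^ (-((((N - 1 : ℕ) : ℝ) - γ / 2) / 2))) := by
  have : Nonempty (Fin N) := ⟨⟨0, Nat.pos_of_ne_zero hN⟩⟩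
  have : Nontrivial (Space N) := inferInstance
  obtain ⟨C, hC, hbd⟩ := exists_radial_pointwise_bound hN hγ hρ hρ1
  set σ : ℝ := ((N - 1 : ℕ) : ℝ) - γ / 2 with hσ
  -- `c⁻¹` converts the weight `‖x‖^(-γ)` into `V`, and `1` keeps the gradient term. The `4` in `M`
  -- is `2·1 + 2·1`, the energy bound for approximants at distance less than `1`.
  set k : ℝ := max 1 c⁻¹ with hk
  have hk0 : 0 ≤ k := le_trans zero_le_one (le_max_left _ _)
  set M : ℝ := k * 4 with hM
  have hM0 : 0 ≤ M := by positivity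
  refine ⟨√(C * M), Real.sqrt_nonneg _, ?_⟩
  rintro u ⟨hu, happ⟩ hu1
  set b : Space N → ℝ≥0∞ := fun x => ENNReal.ofReal (√(C * M) * ‖x‖ ^ (-(σ / 2))) with hb
  have hne : ∀ᵐ x : Space N, x ≠ 0 := by simp [ae_iff]
  have hVm := aemeasurable_potential_norm (N := N) hN hV
  -- Subtraction in `ℝ≥0∞` is truncated, so this measures the positive part of `|u| - b`. Since `|φ|
  -- ≤ b`, it is at most `|u - φ|`; no almost everywhere convergent subsequence is needed.
  have hsmall : ∀ ε : ℝ≥0∞, 0 < ε → ε ≤ 1 →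
      ∫⁻ x in Metric.ball (0 : Space N) (ρ / 2), V ‖x‖ * (‖u x‖ₑ - b x) ^ 2 ≤ ε := by
    intro ε hε hε1
    obtain ⟨φ, hφ, -, hdist⟩ := happ ε hε
    have hd := lintegral_le_of_normHV_lt hdist hε1
    have hen := lintegral_energy_smooth_le hN hV hu.1 hφ.1 hφ.2.1
    rw [lintegral_eq_one_of_normHV hu1] at hen
    have hen' : ∫⁻ x, (‖fderiv ℝ φ x‖ₑ ^ 2 + V ‖x‖ * ‖φ x‖ₑ ^ 2) ≤ 4 := by
      refine hen.trans ?_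
      calc _ ≤ (2 : ℝ≥0∞) * 1 + 2 * 1 := by gcongr; exact hd.trans hε1
        _ = 4 := by norm_num
    have hball : ∫⁻ x in Metric.ball (0 : Space N) ρ,
        (‖fderiv ℝ φ x‖ₑ ^ 2 + ENNReal.ofReal (‖x‖ ^ (-γ)) * ‖φ x‖ₑ ^ 2) ≤
          ENNReal.ofReal M := by
      calc _ ≤ ∫⁻ x in Metric.ball (0 : Space N) ρ,
              ENNReal.ofReal k * (‖fderiv ℝ φ x‖ₑ ^ 2 + V ‖x‖ * ‖φ x‖ₑ ^ 2) := by
            refine lintegral_mono_ae ?_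
            filter_upwards [ae_restrict_of_ae hlow, ae_restrict_mem measurableSet_ball]
              with x hx hxb
            have hx' := hx (by simpa using hxb)
            have h1 : ENNReal.ofReal (‖x‖ ^ (-γ)) ≤ ENNReal.ofReal k * V ‖x‖ := by
              calc ENNReal.ofReal (‖x‖ ^ (-γ))
                  = ENNReal.ofReal c⁻¹ * ENNReal.ofReal (c * ‖x‖ ^ (-γ)) := by
                    rw [← ENNReal.ofReal_mul (by positivity), inv_mul_cancel_left₀ hc.ne']
                _ ≤ _ := mul_le_mul' (ENNReal.ofReal_le_ofReal (le_max_right _ _)) hx'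
            have h2 : (1 : ℝ≥0∞) ≤ ENNReal.ofReal k := by
              rw [← ENNReal.ofReal_one]
              exact ENNReal.ofReal_le_ofReal (le_max_left _ _)
            rw [mul_add, ← mul_assoc]
            exact add_le_add (le_mul_of_one_le_left' h2) (mul_le_mul_left h1 _)
        _ ≤ ∫⁻ x, ENNReal.ofReal k * (‖fderiv ℝ φ x‖ₑ ^ 2 + V ‖x‖ * ‖φ x‖ₑ ^ 2) :=
            setLIntegral_le_lintegral _ _
        _ ≤ ENNReal.ofReal k * 4 := by
            rw [lintegral_const_mul' _ _ ENNReal.ofReal_ne_top]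
            gcongr
        _ = ENNReal.ofReal M := by
            rw [hM, ENNReal.ofReal_mul hk0]
            norm_num
    have hpt := hbd φ hφ M hM0 hball
    refine le_trans ?_ hd
    refine le_trans (lintegral_mono_ae ?_) (setLIntegral_le_lintegral _ _)
    filter_upwards [ae_restrict_of_ae hne, ae_restrict_mem measurableSet_ball] with x hx hxb
    have hxn : 0 < ‖x‖ := norm_pos_iff.2 hx
    have h := hpt x hx (by simpa using hxb)
    have hφb : ‖φ x‖ₑ ≤ b x := by
      rw [← ofReal_norm]
      refine ENNReal.ofReal_le_ofReal ?_
      have hsq : (‖x‖ ^ (σ / 2)) ^ 2 = ‖x‖ ^ σ := by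
        rw [← Real.rpow_natCast, ← Real.rpow_mul hxn.le]; congr 1; push_cast; ring
      rw [Real.rpow_neg hxn.le, ← div_eq_mul_inv, le_div_iff₀ (by positivity)]
      refine Real.le_sqrt_of_sq_le ?_
      rw [mul_pow, hsq, Real.norm_eq_abs, sq_abs, mul_comm]
      exact h
    refine le_trans ?_ le_add_self
    gcongr
    rw [tsub_le_iff_right]
    calc ‖u x‖ₑ = ‖(u - φ) x + φ x‖ₑ := by simp
      _ ≤ ‖(u - φ) x‖ₑ + ‖φ x‖ₑ := enorm_add_le _ _
      _ ≤ _ := by gcongr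
  have hzero : ∫⁻ x in Metric.ball (0 : Space N) (ρ / 2), V ‖x‖ * (‖u x‖ₑ - b x) ^ 2 = 0 := by
    by_contra hA
    set A := ∫⁻ x in Metric.ball (0 : Space N) (ρ / 2), V ‖x‖ * (‖u x‖ₑ - b x) ^ 2
    have h1 := hsmall 1 one_pos le_rfl
    have h2 := hsmall (A / 2) (ENNReal.half_pos hA)
      ((ENNReal.half_le_self).trans h1)
    exact absurd h2 (not_le.2 (ENNReal.half_lt_self hA (h1.trans_lt ENNReal.one_lt_top).ne))
  have hbm : Measurable b := by fun_prop
  have hm : AEMeasurable fun x : Space N => V ‖x‖ * (‖u x‖ₑ - b x) ^ 2 :=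
    hVm.mul ((hu.1.1.1.enorm.sub hbm.aemeasurable).pow_const 2)
  rw [lintegral_eq_zero_iff' hm.restrict, EventuallyEq, ae_restrict_iff' measurableSet_ball] at hzero
  filter_upwards [hzero, hne, hlow] with x h1 h2 h3 hx
  have h4 := h1 (by simpa using hx)
  -- The weighted integral controls `u` only where `V` is nonzero, which the lower bound ensures.
  have hVpos : V ‖x‖ ≠ 0 := by
    have hxn : 0 < ‖x‖ := norm_pos_iff.2 h2
    refine (lt_of_lt_of_le ?_ (h3 (by linarith))).ne'
    exact ENNReal.ofReal_pos.2 (by positivity)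
  simp only [Pi.zero_apply, mul_eq_zero, hVpos, false_or] at h4
  exact tsub_eq_zero_iff_le.1 (pow_eq_zero_iff (two_ne_zero) |>.1 h4)

/-! ### Powers of the radius and of the potential. -/

/-- For `d > -N` the power is integrable on the unit ball; absolute continuity of the integral does
the rest. -/
theorem tendsto_lintegral_ball_rpow {N : ℕ} (hN : N ≠ 0) {d : ℝ} (hd : -(N : ℝ) < d) :
    Tendsto (fun R : ℝ => ∫⁻ x in Metric.ball (0 : Space N) R, ENNReal.ofReal (‖x‖ ^ d))
      (𝓝[>] 0) (𝓝 0) := by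
  have : Nonempty (Fin N) := ⟨⟨0, Nat.pos_of_ne_zero hN⟩⟩
  have : Nontrivial (Space N) := inferInstance
  have hint : IntegrableOn (fun x : Space N => ‖x‖ ^ d) (Metric.ball 0 1) := by
    refine (integrableOn_fun_norm_addHaar volume (f := fun r : ℝ => r ^ d)).2 ?_
    have h1 : IntegrableOn (fun r : ℝ => r ^ (((N - 1 : ℕ) : ℝ) + d)) (Ioo 0 1) := by
      rw [intervalIntegral.integrableOn_Ioo_rpow_iff one_pos]
      rw [Nat.cast_pred (Nat.pos_of_ne_zero hN)]
      linarith
    refine h1.congr_fun (fun r hr => ?_) measurableSet_Ioo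
    simp [Real.rpow_add hr.1]
  have hfin : ∫⁻ x in Metric.ball (0 : Space N) 1, ENNReal.ofReal (‖x‖ ^ d) ≠ ⊤ := by
    have := hint.2
    rw [hasFiniteIntegral_iff_ofReal (Eventually.of_forall fun x => by positivity)] at this
    exact this.ne
  have hvol : Tendsto (fun R : ℝ => volume (Metric.ball (0 : Space N) R)) (𝓝[>] 0) (𝓝 0) := by
    have h0 : Tendsto (fun R : ℝ => ENNReal.ofReal (R ^ N) * volume (Metric.ball (0 : Space N) 1))
        (𝓝[>] 0) (𝓝 (ENNReal.ofReal (0 ^ N) * volume (Metric.ball (0 : Space N) 1))) := by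
      refine ENNReal.Tendsto.mul_const ?_ (Or.inr measure_ball_lt_top.ne)
      refine ENNReal.tendsto_ofReal (Tendsto.mono_left ?_ nhdsWithin_le_nhds)
      exact (continuous_pow N).tendsto 0
    rw [zero_pow hN, ENNReal.ofReal_zero, zero_mul] at h0
    refine h0.congr' ?_
    filter_upwards [self_mem_nhdsWithin] with R hR
    rw [Measure.addHaar_ball volume (0 : Space N) (le_of_lt hR)]
    simp
  have hsmall : ∀ᶠ R : ℝ in 𝓝[>] 0, R < 1 :=
    mem_nhdsWithin_of_mem_nhds (Iio_mem_nhds one_pos)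
  have key := tendsto_setLIntegral_zero (μ := volume.restrict (Metric.ball (0 : Space N) 1)) hfin
    (s := fun R : ℝ => Metric.ball (0 : Space N) R) (l := 𝓝[>] 0)
    (tendsto_of_tendsto_of_tendsto_of_le_of_le tendsto_const_nhds hvol (fun _ => zero_le)
      fun R => Measure.restrict_apply_le _ _)
  refine key.congr' ?_
  filter_upwards [hsmall] with R hR
  rw [Measure.restrict_restrict measurableSet_ball,
    inter_eq_left.2 (Metric.ball_subset_ball hR.le)]

/-- A lower bound on `V` lets the power of `V` in a weighted upper bound be raised. -/
theorem le_mul_rpow_of_le {k S W : ℝ≥0∞} {r α β δ γ c : ℝ} (hr : 0 < r) (hc : 0 < c)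
    (hβ : 0 ≤ β) (hδ : 0 ≤ δ) (hk : k ≤ S * (ENNReal.ofReal (r ^ α) * W ^ β))
    (hW : ENNReal.ofReal (c * r ^ (-γ)) ≤ W) :
    k ≤ S * ENNReal.ofReal (c ^ (-δ)) * (ENNReal.ofReal (r ^ (α + γ * δ)) * W ^ (β + δ)) := by
  have h1 : ENNReal.ofReal ((c * r ^ (-γ)) ^ δ) ≤ W ^ δ := by
    rw [← ENNReal.ofReal_rpow_of_pos (by positivity)]
    exact ENNReal.rpow_le_rpow hW hδ
  have h2 : r ^ α = c ^ (-δ) * (r ^ (α + γ * δ) * (c * r ^ (-γ)) ^ δ) := by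
    rw [Real.mul_rpow hc.le (by positivity), ← Real.rpow_mul hr.le, Real.rpow_add hr,
      Real.rpow_neg hc.le, neg_mul, Real.rpow_neg hr.le]
    field_simp
  refine hk.trans ?_
  rw [h2, ENNReal.ofReal_mul (by positivity), ENNReal.ofReal_mul (by positivity),
    ENNReal.rpow_add_of_nonneg _ _ hβ hδ]
  calc _ ≤ S * (ENNReal.ofReal (c ^ (-δ)) * (ENNReal.ofReal (r ^ (α + γ * δ)) * W ^ δ) * W ^ β) := by
        gcongr
    _ = _ := by ring

/-! ### Arithmetic of the region. -/

theorem lt_of_mem_region {N : ℕ} {α β γ q : ℝ} (h : (α, q) ∈ region N β γ) :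
    1 < q ∧ 2 * β < q := by
  simp only [region, mem_ofPred_eq] at h
  split_ifs at h <;> simp only [max_lt_iff] at h <;> tauto

/-- Clearing the denominator of `q_*`, whose sign changes at `γ = N`, unifies the branches. For `q <
2` this says that the Hölder exponent exceeds `-N`. -/
theorem mul_lt_of_mem_region {N : ℕ} {α β γ q : ℝ}
    (h : (α, q) ∈ region N β γ) : q * (N - γ) < 2 * (α - γ * β + N) := by
  simp only [region, mem_ofPred_eq, qStar, max_lt_iff, lt_min_iff, ← mul_div_assoc] at h
  have neg : (N : ℝ) < γ → 2 * (α - γ * β + N) / (N - γ) < q →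
      q * (N - γ) < 2 * (α - γ * β + N) := fun h1 h2 =>
    (div_lt_iff_of_neg (by linarith)).1 h2
  split_ifs at h with h1 h2 h3 h4
  · exact (lt_div_iff₀ (by linarith)).1 h.2.1
  · subst h2; nlinarith [h.2.2]
  all_goals
    have h5 : (N : ℝ) < γ := lt_of_le_of_ne (not_lt.1 h1) (Ne.symm h2)
    exact neg h5 (by tauto)

/-- The analogue for `q_**`, with sign change at `γ = 2N - 2`, where the left side vanishes. It
makes the final power of `R` positive when `q ≥ 2`. -/
theorem sub_two_mul_lt_of_mem_region {N : ℕ} (hN : 3 ≤ N) {α β γ q : ℝ}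
    (h : (α, q) ∈ region N β γ) :
    (q - 2) * (((N - 1 : ℕ) : ℝ) - γ / 2) / 2 < α + γ * (1 - β) := by
  have hN' : (3 : ℝ) ≤ N := by exact_mod_cast hN
  rw [Nat.cast_pred (by omega)]
  simp only [region, mem_ofPred_eq, qStarStar, max_lt_iff, lt_min_iff, ← mul_div_assoc] at h
  have pos : γ < 2 * (N : ℝ) - 2 →
      q < 2 * (2 * α + (1 - 2 * β) * γ + 2 * ((N : ℝ) - 1)) / (2 * ((N : ℝ) - 1) - γ) →
      (q - 2) * ((N : ℝ) - 1 - γ / 2) / 2 < α + γ * (1 - β) := fun h1 h2 => by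
    rw [lt_div_iff₀ (by linarith)] at h2
    linarith
  split_ifs at h with h1 h2 h3 h4
  · exact pos (by linarith) h.2.2
  · exact pos (by linarith) h.2.1
  · exact pos h3 h.2
  · have : (N : ℝ) - 1 - γ / 2 = 0 := by linarith
    rw [this]
    linarith [h.2]
  · have h5 : 2 * (N : ℝ) - 2 < γ := lt_of_le_of_ne (not_lt.1 h3) (Ne.symm h4)
    have h6 := (div_lt_iff_of_neg (by linarith)).1 h.2
    linarith

/-! ### Bounds on the supremum. -/

theorem R0_le {N : ℕ} {V : ℝ → ℝ≥0∞} {K : ℝ → ℝ} {q R : ℝ} {B : ℝ≥0∞}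
    (h : ∀ u ∈ HVrad (N := N) V, ∀ h ∈ HV (N := N) V, normHV V u = 1 → normHV V h = 1 →
      ∫⁻ x in Metric.ball (0 : Space N) R,
        ENNReal.ofReal (K ‖x‖) * ‖u x‖ₑ ^ (q - 1) * ‖h x‖ₑ ≤ B) :
    R0 N V K q R ≤ B :=
  iSup_le fun u => iSup_le fun w => iSup_le fun hu => iSup_le fun hw => iSup_le fun hu1 =>
    iSup_le fun hw1 => h u hu w hw hu1 hw1

theorem lintegral_potential_le_one {N : ℕ} {V : ℝ → ℝ≥0∞} {u : Space N → ℝ}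
    (hu : normHV V u = 1) : ∫⁻ x, V ‖x‖ * ‖u x‖ₑ ^ 2 ≤ 1 := by
  rw [← lintegral_eq_one_of_normHV hu]
  exact lintegral_mono fun x => le_add_self

/-- The estimate for `q < 2`, by Hölder's inequality. -/
theorem R0_le_of_lt_two {N : ℕ} (hN : N ≠ 0) {V : ℝ → ℝ≥0∞} {K : ℝ → ℝ}
    (hV : AEMeasurable V (volume.restrict (Ioi 0))) {q R a : ℝ} (hq1 : 1 < q) (hq2 : q < 2)
    {S : ℝ≥0∞} (hS : S ≠ ⊤)
    (hK : ∀ᵐ x : Space N, ‖x‖ < R → ENNReal.ofReal (K ‖x‖) ≤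
      S * (ENNReal.ofReal (‖x‖ ^ a) * V ‖x‖ ^ (q / 2))) :
    R0 N V K q R ≤ S * (∫⁻ x in Metric.ball (0 : Space N) R,
      ENNReal.ofReal (‖x‖ ^ (2 / (2 - q) * a))) ^ ((2 - q) / 2) := by
  have : Nonempty (Fin N) := ⟨⟨0, Nat.pos_of_ne_zero hN⟩⟩
  have : Nontrivial (Space N) := inferInstance
  have hne : ∀ᵐ x : Space N, x ≠ 0 := by simp [ae_iff]
  have hVm := aemeasurable_potential_norm (N := N) hN hV
  refine R0_le fun u hu h hh hu1 hh1 => ?_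
  set A : Fin 3 → Space N → ℝ≥0∞ := ![fun x => V ‖x‖ * ‖u x‖ₑ ^ 2, fun x => V ‖x‖ * ‖h x‖ₑ ^ 2,
    fun x => ENNReal.ofReal (‖x‖ ^ (2 / (2 - q) * a))] with hA
  -- These exponents sum to one and reproduce `|u|^(q-1) |h|` with total weight `V^(q/2)`; the first
  -- two integrals are at most one.
  set p : Fin 3 → ℝ := ![(q - 1) / 2, 1 / 2, (2 - q) / 2] with hp
  have hmu : AEMeasurable fun x : Space N => V ‖x‖ * ‖u x‖ₑ ^ 2 :=
    hVm.mul (hu.1.1.1.1.enorm.pow_const 2)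
  have hmh : AEMeasurable fun x : Space N => V ‖x‖ * ‖h x‖ₑ ^ 2 :=
    hVm.mul (hh.1.1.1.enorm.pow_const 2)
  have holder := ENNReal.lintegral_prod_norm_pow_le (μ := volume.restrict (Metric.ball 0 R))
    Finset.univ (f := A) (p := p)
    (by
      intro i _
      fin_cases i
      · exact hmu.restrict
      · exact hmh.restrict
      · exact Measurable.aemeasurable (by simp only [hA]; measurability))
    (by simp only [hp, Fin.sum_univ_three, Matrix.cons_val]; ring)
    (by intro i _; fin_cases i <;> simp [hp] <;> linarith)
  simp only [Fin.prod_univ_three, hA, hp, Matrix.cons_val] at holder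
  calc ∫⁻ x in Metric.ball (0 : Space N) R, ENNReal.ofReal (K ‖x‖) * ‖u x‖ₑ ^ (q - 1) * ‖h x‖ₑ
      ≤ ∫⁻ x in Metric.ball (0 : Space N) R, S * ((V ‖x‖ * ‖u x‖ₑ ^ 2) ^ ((q - 1) / 2) *
          (V ‖x‖ * ‖h x‖ₑ ^ 2) ^ (1 / 2 : ℝ) *
          ENNReal.ofReal (‖x‖ ^ (2 / (2 - q) * a)) ^ ((2 - q) / 2)) := by
        refine lintegral_mono_ae ?_
        filter_upwards [ae_restrict_of_ae hK, ae_restrict_of_ae hne,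
          ae_restrict_mem measurableSet_ball] with x hx hx0 hxb
        have hxn : 0 < ‖x‖ := norm_pos_iff.2 hx0
        have hx' := hx (by simpa using hxb)
        have e1 : V ‖x‖ ^ (q / 2) = V ‖x‖ ^ ((q - 1) / 2) * V ‖x‖ ^ (1 / 2 : ℝ) := by
          rw [← ENNReal.rpow_add_of_nonneg _ _ (by linarith) (by norm_num)]
          congr 1; ring
        have e2 : ENNReal.ofReal (‖x‖ ^ (2 / (2 - q) * a)) ^ ((2 - q) / 2)
            = ENNReal.ofReal (‖x‖ ^ a) := by
          rw [ENNReal.ofReal_rpow_of_pos (by positivity), ← Real.rpow_mul hxn.le]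
          congr 2
          have : 2 - q ≠ 0 := by linarith
          field_simp
        have e3 : ∀ t : ℝ≥0∞, ∀ s : ℝ, (t ^ 2) ^ (s / 2) = t ^ s := fun t s => by
          rw [← ENNReal.rpow_natCast, ← ENNReal.rpow_mul]
          congr 1; push_cast; ring
        rw [ENNReal.mul_rpow_of_nonneg _ _ (by linarith : 0 ≤ (q - 1) / 2),
          ENNReal.mul_rpow_of_nonneg _ _ (by norm_num : (0 : ℝ) ≤ 1 / 2), e2, e3, e3,
          ENNReal.rpow_one]
        calc _ ≤ S * (ENNReal.ofReal (‖x‖ ^ a) * V ‖x‖ ^ (q / 2)) * ‖u x‖ₑ ^ (q - 1) * ‖h x‖ₑ := by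
              gcongr
          _ = _ := by rw [e1]; ring
    _ ≤ _ := by
        rw [lintegral_const_mul' _ _ hS]
        gcongr
        refine holder.trans ?_
        have hle : ∀ {w : Space N → ℝ}, normHV V w = 1 → ∀ {s : ℝ}, 0 ≤ s →
            (∫⁻ x in Metric.ball (0 : Space N) R, V ‖x‖ * ‖w x‖ₑ ^ 2) ^ s ≤ 1 :=
          fun hw _ hs => ENNReal.rpow_le_one
            ((setLIntegral_le_lintegral _ _).trans (lintegral_potential_le_one hw)) hs
        exact mul_le_of_le_one_left' (mul_le_one' (hle hu1 (by linarith))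
          (hle hh1 (by norm_num)))

/-- The estimate for `q ≥ 2`, from the pointwise decay of radial functions. -/
theorem R0_le_of_two_le {N : ℕ} (hN : N ≠ 0) {V : ℝ → ℝ≥0∞} {K : ℝ → ℝ}
    (hV : AEMeasurable V (volume.restrict (Ioi 0))) {q R a ν C : ℝ} (hq : 2 ≤ q) (hC : 0 ≤ C)
    (hν : (q - 2) * ν ≤ a) {S : ℝ≥0∞} (hS : S ≠ ⊤)
    (hK : ∀ᵐ x : Space N, ‖x‖ < R → ENNReal.ofReal (K ‖x‖) ≤
      S * (ENNReal.ofReal (‖x‖ ^ a) * V ‖x‖))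
    (hdecay : ∀ u ∈ HVrad (N := N) V, normHV V u = 1 → ∀ᵐ x : Space N, ‖x‖ < R →
      ‖u x‖ₑ ≤ ENNReal.ofReal (C * ‖x‖ ^ (-ν))) :
    R0 N V K q R ≤ S * ENNReal.ofReal (C ^ (q - 2) * R ^ (a - (q - 2) * ν)) * 2 := by
  have : Nonempty (Fin N) := ⟨⟨0, Nat.pos_of_ne_zero hN⟩⟩
  have : Nontrivial (Space N) := inferInstance
  have hne : ∀ᵐ x : Space N, x ≠ 0 := by simp [ae_iff]
  have hVm := aemeasurable_potential_norm (N := N) hN hV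
  refine R0_le fun u hu h hh hu1 hh1 => ?_
  have hmu : AEMeasurable fun x : Space N => V ‖x‖ * ‖u x‖ₑ ^ 2 :=
    hVm.mul (hu.1.1.1.1.enorm.pow_const 2)
  set T : ℝ≥0∞ := ENNReal.ofReal (C ^ (q - 2) * R ^ (a - (q - 2) * ν)) with hT
  calc ∫⁻ x in Metric.ball (0 : Space N) R, ENNReal.ofReal (K ‖x‖) * ‖u x‖ₑ ^ (q - 1) * ‖h x‖ₑ
      ≤ ∫⁻ x in Metric.ball (0 : Space N) R,
          S * T * (V ‖x‖ * ‖u x‖ₑ ^ 2 + V ‖x‖ * ‖h x‖ₑ ^ 2) := by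
        refine lintegral_mono_ae ?_
        filter_upwards [ae_restrict_of_ae hK, ae_restrict_of_ae hne,
          ae_restrict_of_ae (hdecay u hu hu1), ae_restrict_mem measurableSet_ball]
          with x hx hx0 hxu hxb
        have hxR : ‖x‖ < R := by simpa using hxb
        have hxn : 0 < ‖x‖ := norm_pos_iff.2 hx0
        have e1 : ‖u x‖ₑ ^ (q - 1) = ‖u x‖ₑ ^ (q - 2) * ‖u x‖ₑ := by
          conv_rhs => rw [← ENNReal.rpow_one ‖u x‖ₑ, ← ENNReal.rpow_mul, one_mul]
          rw [← ENNReal.rpow_add_of_nonneg _ _ (by linarith) zero_le_one]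
          congr 1; ring
        have e2 : ENNReal.ofReal (‖x‖ ^ a) * ‖u x‖ₑ ^ (q - 2) ≤ T := by
          calc _ ≤ ENNReal.ofReal (‖x‖ ^ a) * ENNReal.ofReal (C * ‖x‖ ^ (-ν)) ^ (q - 2) := by
                gcongr
                exact hxu hxR
            _ = ENNReal.ofReal (C ^ (q - 2) * ‖x‖ ^ (a - (q - 2) * ν)) := by
                rw [ENNReal.ofReal_rpow_of_nonneg (by positivity) (by linarith),
                  ← ENNReal.ofReal_mul (by positivity), Real.mul_rpow hC (by positivity),
                  ← Real.rpow_mul hxn.le, mul_left_comm, ← Real.rpow_add hxn]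
                congr 3; ring
            _ ≤ T := by
                refine ENNReal.ofReal_le_ofReal ?_
                gcongr
        have e3 : ‖u x‖ₑ * ‖h x‖ₑ ≤ ‖u x‖ₑ ^ 2 + ‖h x‖ₑ ^ 2 := by
          rcases le_total ‖u x‖ₑ ‖h x‖ₑ with hle | hle
          · exact (mul_le_mul_left hle _).trans (by rw [sq ‖h x‖ₑ]; exact le_add_self)
          · exact (mul_le_mul_right hle _).trans (by rw [sq ‖u x‖ₑ]; exact le_self_add)
        calc _ ≤ S * (ENNReal.ofReal (‖x‖ ^ a) * V ‖x‖) * (‖u x‖ₑ ^ (q - 2) * ‖u x‖ₑ) *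
                ‖h x‖ₑ := by
              rw [e1]
              gcongr
              exact hx hxR
          _ = S * (ENNReal.ofReal (‖x‖ ^ a) * ‖u x‖ₑ ^ (q - 2)) *
                (V ‖x‖ * (‖u x‖ₑ * ‖h x‖ₑ)) := by ring
          _ ≤ S * T * (V ‖x‖ * (‖u x‖ₑ ^ 2 + ‖h x‖ₑ ^ 2)) := by gcongr
          _ = _ := by rw [mul_add (V ‖x‖)]
    _ ≤ S * T * (1 + 1) := by
        rw [lintegral_const_mul' _ _ (ENNReal.mul_ne_top hS ENNReal.ofReal_ne_top),
          lintegral_add_left' hmu.restrict]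
        gcongr
        · exact (setLIntegral_le_lintegral _ _).trans (lintegral_potential_le_one hu1)
        · exact (setLIntegral_le_lintegral _ _).trans (lintegral_potential_le_one hh1)
    _ = S * T * 2 := by rw [one_add_one_eq_two]

/-! ### From essential bounds to almost everywhere bounds, and conclusion. -/

theorem exists_bounds {V : ℝ → ℝ≥0∞} {K : ℝ → ℝ} {N : ℕ} (hN : N ≠ 0)
    (hVfin : ∀ᵐ r ∂(volume.restrict (Ioi (0 : ℝ))), V r < ⊤) {R₁ α β γ : ℝ} (hβ : 0 ≤ β)
    (hsup : essSup (fun r : ℝ => ENNReal.ofReal (K r) / (ENNReal.ofReal (r ^ α) * V r ^ β))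
      (volume.restrict (Ioo 0 R₁)) < ⊤)
    (hinf : 0 < essInf (fun r : ℝ => ENNReal.ofReal (r ^ γ) * V r)
      (volume.restrict (Ioo 0 R₁))) :
    ∃ c : ℝ, 0 < c ∧ ∃ S : ℝ≥0∞, S ≠ ⊤ ∧ ∀ᵐ x : Space N, ‖x‖ < R₁ →
      ENNReal.ofReal (c * ‖x‖ ^ (-γ)) ≤ V ‖x‖ ∧
      ENNReal.ofReal (K ‖x‖) ≤ S * (ENNReal.ofReal (‖x‖ ^ α) * V ‖x‖ ^ β) := by
  have : Nonempty (Fin N) := ⟨⟨0, Nat.pos_of_ne_zero hN⟩⟩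
  have : Nontrivial (Space N) := inferInstance
  obtain ⟨c, hc0, hcI⟩ := ENNReal.lt_iff_exists_nnreal_btwn.1 hinf
  have hc0' : 0 < (c : ℝ) := by exact_mod_cast hc0
  refine ⟨c, hc0', _, hsup.ne, ?_⟩
  set S := essSup (fun r : ℝ => ENNReal.ofReal (K r) / (ENNReal.ofReal (r ^ α) * V r ^ β))
    (volume.restrict (Ioo 0 R₁))
  have hlow := ae_essInf_le (f := fun r : ℝ => ENNReal.ofReal (r ^ γ) * V r)
    (μ := volume.restrict (Ioo 0 R₁))
  have hup := ENNReal.ae_le_essSup (μ := volume.restrict (Ioo 0 R₁))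
    (fun r : ℝ => ENNReal.ofReal (K r) / (ENNReal.ofReal (r ^ α) * V r ^ β))
  rw [ae_restrict_iff' measurableSet_Ioo] at hlow hup
  have h1d : ∀ᵐ r ∂(volume.restrict (Ioi (0 : ℝ))), r < R₁ →
      ENNReal.ofReal (c * r ^ (-γ)) ≤ V r ∧
      ENNReal.ofReal (K r) ≤ S * (ENNReal.ofReal (r ^ α) * V r ^ β) := by
    filter_upwards [ae_restrict_of_ae hlow, ae_restrict_of_ae hup, hVfin,
      ae_restrict_mem measurableSet_Ioi] with r h1 h2 h3 hr hrR
    have hr0 : 0 < r := hr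
    have hcV : ENNReal.ofReal (c * r ^ (-γ)) ≤ V r := by
      have h4 : ENNReal.ofReal c ≤ ENNReal.ofReal (r ^ γ) * V r := by
        rw [ENNReal.ofReal_coe_nnreal]
        exact hcI.le.trans (h1 ⟨hr0, hrR⟩)
      calc ENNReal.ofReal (c * r ^ (-γ)) = ENNReal.ofReal (r ^ (-γ)) * ENNReal.ofReal c := by
            rw [mul_comm, ENNReal.ofReal_mul (by positivity)]
        _ ≤ ENNReal.ofReal (r ^ (-γ)) * (ENNReal.ofReal (r ^ γ) * V r) := by gcongr
        _ = V r := by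
            rw [← mul_assoc, ← ENNReal.ofReal_mul (by positivity), ← Real.rpow_add hr0]
            simp
    refine ⟨hcV, ?_⟩
    have hVpos : 0 < V r := lt_of_lt_of_le (ENNReal.ofReal_pos.2 (by positivity)) hcV
    -- Clearing the quotient in `ℝ≥0∞` requires a denominator that is neither `0` nor `⊤`:
    -- positivity of `V` comes from the lower bound, finiteness from `hVfin`.
    refine (ENNReal.div_le_iff ?_ ?_).1 (h2 ⟨hr0, hrR⟩)
    · exact mul_ne_zero (ENNReal.ofReal_pos.2 (by positivity)).ne'
        (ENNReal.rpow_pos hVpos h3.ne).ne'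
    · exact ENNReal.mul_ne_top ENNReal.ofReal_ne_top (ENNReal.rpow_ne_top_of_nonneg hβ h3.ne)
  exact (quasiMeasurePreserving_norm (volume : Measure (Space N))).ae h1d

end RadialSobolev

theorem theorem2p7 (N : ℕ) (hN : 3 ≤ N) (V : ℝ → ℝ≥0∞) (K : ℝ → ℝ)
    (hV : RadialSobolev.AssumptionV V) (hK : RadialSobolev.AssumptionK N K)
    (hVfin : ∀ᵐ r ∂(volume.restrict (Ioi (0 : ℝ))), V r < ⊤)
    (R₁ : ℝ) (hR₁ : 0 < R₁)
    (α₀ β₀ γ₀ : ℝ) (hβ₀ : 0 ≤ β₀) (hβ₁ : β₀ ≤ 1) (hγ₀ : 2 ≤ γ₀)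
    (hsup : essSup (fun r : ℝ => ENNReal.ofReal (K r) / (ENNReal.ofReal (r ^ α₀) * V r ^ β₀))
      (volume.restrict (Ioo 0 R₁)) < ⊤)
    (hinf : 0 < essInf (fun r : ℝ => ENNReal.ofReal (r ^ γ₀) * V r)
      (volume.restrict (Ioo 0 R₁)))
    (q₁ : ℝ) (hq₁ : (α₀, q₁) ∈ RadialSobolev.region N β₀ γ₀) :
    Tendsto (fun R : ℝ => RadialSobolev.R0 N V K q₁ R) (𝓝[>] 0) (𝓝 0) := by
  have hN0 : N ≠ 0 := by omega
  have : Nonempty (Fin N) := ⟨⟨0, by omega⟩⟩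
  have hne : ∀ᵐ x : RadialSobolev.Space N, x ≠ 0 := by simp [ae_iff]
  obtain ⟨c, hc, S, hS, hb⟩ := RadialSobolev.exists_bounds hN0 hVfin hβ₀ hsup hinf
  obtain ⟨h1q, hβq⟩ := RadialSobolev.lt_of_mem_region hq₁
  have hsmall : ∀ t : ℝ, 0 < t → ∀ᶠ R : ℝ in 𝓝[>] 0, R < t := fun t ht =>
    mem_nhdsWithin_of_mem_nhds (Iio_mem_nhds ht)
  rcases lt_or_ge q₁ 2 with hq2 | hq2
  -- The power of `V` is raised by `q₁ / 2 - β₀`, which is positive because `q₁ > 2 β₀`.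
  · set a : ℝ := α₀ + γ₀ * (q₁ / 2 - β₀) with ha
    set S' : ℝ≥0∞ := S * ENNReal.ofReal (c ^ (-(q₁ / 2 - β₀))) with hS'
    have hS'top : S' ≠ ⊤ := ENNReal.mul_ne_top hS ENNReal.ofReal_ne_top
    have hd : -(N : ℝ) < 2 / (2 - q₁) * a := by
      have := RadialSobolev.mul_lt_of_mem_region hq₁
      rw [div_mul_eq_mul_div, lt_div_iff₀ (by linarith), ha]
      linarith
    have hlim : Tendsto (fun R : ℝ => S' * (∫⁻ x in Metric.ball (0 : RadialSobolev.Space N) R,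
        ENNReal.ofReal (‖x‖ ^ (2 / (2 - q₁) * a))) ^ ((2 - q₁) / 2)) (𝓝[>] 0) (𝓝 0) := by
      have h1 := (ENNReal.continuous_rpow_const (y := (2 - q₁) / 2)).tendsto 0 |>.comp
        (RadialSobolev.tendsto_lintegral_ball_rpow hN0 hd)
      have h2 := ENNReal.Tendsto.const_mul h1 (Or.inr hS'top)
      rw [ENNReal.zero_rpow_of_pos (by linarith), mul_zero] at h2
      exact h2
    refine tendsto_of_tendsto_of_tendsto_of_le_of_le' tendsto_const_nhds hlim
      (Eventually.of_forall fun _ => zero_le) ?_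
    filter_upwards [hsmall R₁ hR₁] with R hR
    refine RadialSobolev.R0_le_of_lt_two hN0 hV.1 h1q hq2 hS'top ?_
    filter_upwards [hb, hne] with x hx hx0 hxR
    obtain ⟨hx1, hx2⟩ := hx (hxR.trans hR)
    have := RadialSobolev.le_mul_rpow_of_le (norm_pos_iff.2 hx0) hc hβ₀
      (by linarith : 0 ≤ q₁ / 2 - β₀) hx2 hx1
    rwa [add_sub_cancel] at this
  -- The cap at `1` serves the comparison of powers in the decay estimate.
  · set ρ : ℝ := min R₁ 1 with hρ
    have hρ0 : 0 < ρ := lt_min hR₁ one_pos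
    have hlow : ∀ᵐ x : RadialSobolev.Space N, ‖x‖ < ρ →
        ENNReal.ofReal (c * ‖x‖ ^ (-γ₀)) ≤ V ‖x‖ := by
      filter_upwards [hb] with x hx hxρ using (hx (hxρ.trans_le (min_le_left _ _))).1
    obtain ⟨C, hC, hdecay⟩ := RadialSobolev.exists_HVrad_pointwise_bound hN0 hV.1 hγ₀ hρ0
      (min_le_right _ _) hc hlow
    set a : ℝ := α₀ + γ₀ * (1 - β₀) with ha
    set ν : ℝ := (((N - 1 : ℕ) : ℝ) - γ₀ / 2) / 2 with hν
    set S' : ℝ≥0∞ := S * ENNReal.ofReal (c ^ (-(1 - β₀))) with hS'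
    have hS'top : S' ≠ ⊤ := ENNReal.mul_ne_top hS ENNReal.ofReal_ne_top
    have hθ : 0 < a - (q₁ - 2) * ν := by
      have := RadialSobolev.sub_two_mul_lt_of_mem_region hN hq₁
      rw [hν, ← mul_div_assoc]
      linarith
    have hlim : Tendsto (fun R : ℝ => S' *
        ENNReal.ofReal (C ^ (q₁ - 2) * R ^ (a - (q₁ - 2) * ν)) * 2) (𝓝[>] 0) (𝓝 0) := by
      have h1 : Tendsto (fun R : ℝ => C ^ (q₁ - 2) * R ^ (a - (q₁ - 2) * ν)) (𝓝[>] 0)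
          (𝓝 (C ^ (q₁ - 2) * 0 ^ (a - (q₁ - 2) * ν))) :=
        ((Real.continuousAt_rpow_const 0 _ (Or.inr hθ.le)).tendsto.mono_left
          nhdsWithin_le_nhds).const_mul _
      have h2 := ENNReal.Tendsto.mul_const (ENNReal.Tendsto.const_mul (ENNReal.tendsto_ofReal h1)
        (Or.inr hS'top)) (Or.inr (ENNReal.ofNat_ne_top (n := 2)))
      rw [Real.zero_rpow hθ.ne', mul_zero, ENNReal.ofReal_zero, mul_zero, zero_mul] at h2
      exact h2
    refine tendsto_of_tendsto_of_tendsto_of_le_of_le' tendsto_const_nhds hlim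
      (Eventually.of_forall fun _ => zero_le) ?_
    filter_upwards [hsmall (ρ / 2) (by positivity)] with R hR
    refine RadialSobolev.R0_le_of_two_le hN0 hV.1 hq2 hC (by linarith) hS'top ?_ ?_
    · filter_upwards [hb, hne] with x hx hx0 hxR
      obtain ⟨hx1, hx2⟩ := hx (by linarith [min_le_left R₁ 1])
      have := RadialSobolev.le_mul_rpow_of_le (norm_pos_iff.2 hx0) hc hβ₀
        (by linarith : 0 ≤ 1 - β₀) hx2 hx1
      rwa [add_sub_cancel, ENNReal.rpow_one] at this
    · intro u hu hu1
      filter_upwards [hdecay u hu hu1] with x hx hxR using hx (hxR.trans hR)
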